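/- **Setting.** Let $G$ be a graph whose vertices $i$ are measurements $M_i$ with outcomes $\pm1$ and whose edges $\{i,j\}$ are the contexts (jointly performed pairs). A behaviour is a family of real numbers $P(ab|ij)$, $a,b\in\{-1,1\}$, $\{i,j\}$ an edge, with $P(ab|ij)=P(ba|ji)$. It is *no-disturbance* if it is nonnegative, normalized in each context, and the marginal $P(a|i)=\sum_b P(ab|ij)$ does not depend on $j$. The *noncontextual polytope* $NC(G)$ is the convex hull of the deterministic behaviours given by assignments $s_i\in\{-1,1\}$ ($P(ab|ij)=1$ if $a=s_i$, $b=s_j$, and $0$ otherwise). An inequality is *tight* if it is facet-defining for $NC(G)$. Put $\langle M_i\rangle=P(1|i)-P(-1|i)$ (computed in any chosen context containing $i$) and $\langle M_iM_j\rangle=P(a=b|ij)-P(a\neq b|ij)$. The events $(ab|ij)$ are the vertices of a hypergraph whose hyperedges are the sets $\{(ab|ij):a,b=\pm1\}$ and $\{(-1,b|ij):b=\pm1\}\cup\{(1,c|ik):c=\pm1\}$. Two distinct events are orthogonal if they lie in a common hyperedge. The *Consistent Exclusivity* (CE$^1$) constraints are $\sum_{v\in S}P(v)\le 1$ for all sets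 $S$ of mutually orthogonal events. A behaviour is *quantum* if $P(v)=\mathrm{tr}(\rho Q_v)$ for a density operator $\rho$ and projectors $Q_v$ on some complex Hilbert space such that the $Q_v$ of each hyperedge are mutually orthogonal and sum to the identity. The cut polytope $CUT(\Gamma)$ of a graph $\Gamma$ is the convex hull in $\mathbb R^{E(\Gamma)}$ of the edge incidence vectors of the cuts of $\Gamma$, and the suspension graph $\nabla G$ arises from $G$ by adding a new vertex $O$ adjacent to all vertices of $G$. **Theorem.** There exist tight noncontextuality inequalities with no quantum violation that are violated by no-disturbance behaviours and are not Consistent Exclusivity constraints. Explicitly, let $G=K_4$ with vertices $1,2,3,4$, so that $\nabla K_4$ is the complete graph $K_5$ with fifth vertex $5=O$, and let $b_1=b_2=b_3=1$, $b_4=b_5=-1$. Then: 1. The pentagonal inequality $\sum_{1\le i<j\le 5}b_ib_jx_{ij}\le 0$ is facet-defining for $CUT(K_5)$. 2. The map $P\mapsto x$ given by $\langle M_iM_j\rangle=1-2x_{ij}$, $\langle M_i\rangle=1-2x_{iO}$ restricts to a bijection from $NC(K_4)$ onto $CUT(\nabla K_4)$, and $\sum_{i<j}b_ib_jx_{ij}=\tfrac12\bigl(f(P)-2\bigr)$,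 where $$f(P)=\sum_{1\le i<j\le 5}-b_ib_j\langle M_iM_j\rangle,\qquad \langle M_iM_5\rangle:=\langle M_i\rangle .$$ 3. $f(P)\le 2$ is facet-defining for $NC(K_4)$. 4. $f(P)\le 2$ for every quantum behaviour $P$. 5. Some no-disturbance behaviour $P$ has $f(P)>2$, and $P$ can be chosen to satisfy all CE$^1$ constraints. 6. For every set $S$ of mutually orthogonal events, the inequalities $f(P)\le2$ and $\sum_{v\in S}P(v)\le1$ are not equivalent on no-disturbance behaviours, and $\{P\in NC(K_4):f(P)=2\}\ne\{P\in NC(K_4):\sum_{v\in S}P(v)=1\}$. -/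

import Mathlib

universe w

noncomputable section

namespace Contextuality

/-! ## Facets of polytopes -/

/-- `f p ≤ β` is facet-defining for `P`: it is valid on `P`, it is attained on `P`, and the face
`P ∩ {f = β}` has dimension `dim P - 1` (dimensions of affine hulls). -/
def IsFacetDefining {E : Type*} [AddCommGroup E] [Module ℝ E]
    (f : E →ₗ[ℝ] ℝ) (β : ℝ) (P : Set E) : Prop :=
  (∀ p ∈ P, f p ≤ β) ∧ {p ∈ P | f p = β}.Nonempty ∧
    Module.finrank ℝ (vectorSpan ℝ {p ∈ P | f p = β}) + 1 = Module.finrank ℝ (vectorSpan ℝ P)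

/-! ## Cut polytopes and suspension graphs -/

open Classical in
/-- The edge incidence vector of the cut given by the vertex set `S`. -/
def cutVector {V : Type*} (G : SimpleGraph V) (S : Set V) : G.edgeSet → ℝ :=
  fun e => if ∃ i ∈ S, ∃ j ∉ S, (e : Sym2 V) = s(i, j) then 1 else 0

/-- The cut polytope of `G`, inside the space of real functions on the edges of `G`. -/
def cutPolytope {V : Type*} (G : SimpleGraph V) : Set (G.edgeSet → ℝ) :=
  convexHull ℝ (Set.range (cutVector G))

/-- The linear form `x ↦ ∑ b_i b_j x_{ij}`, summed over the edges `{i,j}` of `G`. -/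
def edgeForm {V : Type*} (G : SimpleGraph V) [Fintype G.edgeSet] (b : V → ℝ) :
    (G.edgeSet → ℝ) →ₗ[ℝ] ℝ :=
  ∑ e : G.edgeSet, ((e : Sym2 V).map b).mul • LinearMap.proj e

/-- Adjacency in the suspension graph; the new vertex `O` is `none`. -/
def suspensionAdj {V : Type*} (G : SimpleGraph V) : Option V → Option V → Prop
  | some i, some j => G.Adj i j
  | some _, none => True
  | none, some _ => True
  | none, none => False

/-- The suspension graph `∇G`: one new vertex `O = none`, adjacent to every vertex of `G`. -/
def suspension {V : Type*} (G : SimpleGraph V) : SimpleGraph (Option V) where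
  Adj := suspensionAdj G
  symm := ⟨by
    rintro (_ | i) (_ | j) h
    · exact h
    · trivial
    · trivial
    · exact SimpleGraph.Adj.symm (G := G) h⟩
  loopless := ⟨by
    rintro (_ | i) h
    · exact h
    · exact G.loopless.irrefl i h⟩

instance {V : Type*} (G : SimpleGraph V) [DecidableRel G.Adj] :
    DecidableRel (suspension G).Adj
  | some i, some j => inferInstanceAs (Decidable (G.Adj i j))
  | some _, none => inferInstanceAs (Decidable True)
  | none, some _ => inferInstanceAs (Decidable True)
  | none, none => inferInstanceAs (Decidable False)

section Scenario

variable {V : Type*} [LinearOrder V]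

/-! ## Dichotomic contextuality scenarios given by a compatibility graph

The vertices of `G` are measurements with outcomes `1` and `-1` (elements of `ℤˣ`), the contexts are
the edges of `G`. -/

/-- The events `(ab|ij)`, where `i < j` are adjacent. -/
abbrev Event (G : SimpleGraph V) : Type _ :=
  {p : V × V // p.1 < p.2 ∧ G.Adj p.1 p.2} × ℤˣ × ℤˣ

/-- The event `(ab|ij)` for adjacent `i`, `j` in any order; `(ab|ij)` and `(ba|ji)` are the same. -/
def ev (G : SimpleGraph V) (i j : V) (h : G.Adj i j) (a b : ℤˣ) : Event G :=
  if hlt : i < j then (⟨(i, j), hlt, h⟩, a, b)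
  else (⟨(j, i), lt_of_le_of_ne (not_lt.mp hlt) h.ne', h.symm⟩, b, a)

theorem ev_swap (G : SimpleGraph V) (i j : V) (h : G.Adj i j) (a b : ℤˣ) :
    ev G j i h.symm b a = ev G i j h a b := by
  unfold ev
  rcases lt_trichotomy i j with hij | hij | hij
  · simp [hij, not_lt.mpr hij.le]
  · exact absurd hij h.ne
  · simp [hij, not_lt.mpr hij.le]

/-- No-disturbance behaviours: nonnegative, normalized in each context, and such that the marginal
`P(a|i)` does not depend on the measurement performed together with `i`. -/
def noDisturbance (G : SimpleGraph V) : Set (Event G → ℝ) :=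
  {P | (∀ v, 0 ≤ P v) ∧
    (∀ i j (h : G.Adj i j), ∑ a, ∑ b, P (ev G i j h a b) = 1) ∧
    (∀ i j k (hj : G.Adj i j) (hk : G.Adj i k) (a : ℤˣ),
      ∑ b, P (ev G i j hj a b) = ∑ b, P (ev G i k hk a b))}

/-- The deterministic noncontextual behaviour of an outcome assignment `s`. -/
def deterministic (G : SimpleGraph V) (s : V → ℤˣ) : Event G → ℝ :=
  fun v => if s v.1.1.1 = v.2.1 ∧ s v.1.1.2 = v.2.2 then 1 else 0

/-- The noncontextual polytope. -/
def ncPolytope (G : SimpleGraph V) : Set (Event G → ℝ) :=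
  convexHull ℝ (Set.range (deterministic G))

/-! ### The events hypergraph, exclusivity and quantum behaviours -/

/-- The hyperedge of the four outcomes of the context `{i,j}`. -/
def contextEdge (G : SimpleGraph V) (i j : V) (h : G.Adj i j) : Finset (Event G) :=
  Finset.univ.image fun ab : ℤˣ × ℤˣ => ev G i j h ab.1 ab.2

/-- The hyperedge of the protocol "measure `i`; on outcome `-1` measure `j`, otherwise `k`". -/
def protocolEdge (G : SimpleGraph V) (i j k : V) (hj : G.Adj i j) (hk : G.Adj i k) :
    Finset (Event G) :=
  (Finset.univ.image fun b : ℤˣ => ev G i j hj (-1) b) ∪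
    (Finset.univ.image fun c : ℤˣ => ev G i k hk 1 c)

/-- The hyperedges of the events hypergraph of the scenario. -/
def IsHyperedge (G : SimpleGraph V) (e : Finset (Event G)) : Prop :=
  (∃ i j, ∃ h : G.Adj i j, e = contextEdge G i j h) ∨
    (∃ i j k, ∃ (hj : G.Adj i j) (hk : G.Adj i k), e = protocolEdge G i j k hj hk)

/-- Two distinct events are orthogonal (exclusive) if they lie in a common hyperedge. -/
def Orthogonal (G : SimpleGraph V) (u v : Event G) : Prop :=
  u ≠ v ∧ ∃ e, IsHyperedge G e ∧ u ∈ e ∧ v ∈ e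

/-- Finite sets of mutually orthogonal events. -/
def MutuallyOrthogonal (G : SimpleGraph V) (S : Finset (Event G)) : Prop :=
  (S : Set (Event G)).Pairwise (Orthogonal G)

/-- Consistent Exclusivity for one copy of the system (`CE¹`). -/
def SatisfiesCE (G : SimpleGraph V) (P : Event G → ℝ) : Prop :=
  ∀ S : Finset (Event G), MutuallyOrthogonal G S → ∑ v ∈ S, P v ≤ 1

/-- `T` is a trace class operator with trace `t`: the diagonal sums converge (unconditionally)
to `t` in every orthonormal basis. -/
def HasTrace {H : Type w} [NormedAddCommGroup H] [InnerProductSpace ℂ H]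
    (T : H →L[ℂ] H) (t : ℂ) : Prop :=
  ∀ (ι : Type w) (e : HilbertBasis ι ℂ H), HasSum (fun i => inner ℂ (e i) (T (e i))) t

/-- Quantum behaviours: `P v = tr (ρ Q_v)` for a density operator `ρ` and projectors `Q_v` on some
complex Hilbert space (of any dimension), where the projectors of each hyperedge are mutually
orthogonal and sum to the identity. -/
def quantumSet (G : SimpleGraph V) : Set (Event G → ℝ) :=
  {P | ∃ (H : Type w) (_ : NormedAddCommGroup H) (_ : InnerProductSpace ℂ H)
      (_ : CompleteSpace H) (ρ : H →L[ℂ] H) (Q : Event G → H →L[ℂ] H),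
    ρ.IsPositive ∧ HasTrace ρ 1 ∧
    (∀ v, IsStarProjection (Q v)) ∧
    (∀ e, IsHyperedge G e → ∑ v ∈ e, Q v = 1) ∧
    (∀ u v, Orthogonal G u v → Q u * Q v = 0) ∧
    (∀ v, HasTrace (ρ * Q v) (P v : ℂ))}

/-! ### Correlators and the suspension-graph correspondence -/

/-- The full correlator `⟨M_i M_j⟩ = P(a = b|ij) - P(a ≠ b|ij)`, as a linear form in `P`. -/
def corr (G : SimpleGraph V) (i j : V) (h : G.Adj i j) : (Event G → ℝ) →ₗ[ℝ] ℝ :=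
  ∑ a : ℤˣ, ∑ b : ℤˣ, (if a = b then (1 : ℝ) else -1) •
    LinearMap.proj (R := ℝ) (φ := fun _ : Event G => ℝ) (ev G i j h a b)

/-- The single correlator `⟨M_i⟩ = P(1|i) - P(-1|i)`, with the marginal computed in the context
`{i,j}`, as a linear form in `P`. -/
def single (G : SimpleGraph V) (i j : V) (h : G.Adj i j) : (Event G → ℝ) →ₗ[ℝ] ℝ :=
  ∑ b : ℤˣ, (LinearMap.proj (R := ℝ) (φ := fun _ : Event G => ℝ) (ev G i j h 1 b) -
    LinearMap.proj (R := ℝ) (φ := fun _ : Event G => ℝ) (ev G i j h (-1) b))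

theorem corr_swap (G : SimpleGraph V) (i j : V) (h : G.Adj i j) :
    corr G j i h.symm = corr G i j h := by
  unfold corr
  rw [Finset.sum_comm]
  refine Finset.sum_congr rfl fun b _ => Finset.sum_congr rfl fun a _ => ?_
  rw [ev_swap]
  by_cases hab : a = b
  · rw [if_pos hab, if_pos hab.symm]
  · rw [if_neg hab, if_neg (Ne.symm hab)]

/-- The correlator attached to a pair of vertices of `∇G`: `⟨M_i M_j⟩` for adjacent `i`, `j` in
`G`, and `⟨M_i⟩` for `i` and `O` (so `M_O` is the identity). Pairs that are not edges of `∇G`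
get `0`. The family `c` picks, for each `i`, a context `{i, c i}` from which `⟨M_i⟩` is computed;
on no-disturbance behaviours it has no influence. -/
def pairCorr (G : SimpleGraph V) [DecidableRel G.Adj] (c : ∀ i : V, {j : V // G.Adj i j}) :
    Option V → Option V → ((Event G → ℝ) →ₗ[ℝ] ℝ)
  | some i, some j => if h : G.Adj i j then corr G i j h else 0
  | some i, none => single G i (c i).1 (c i).2
  | none, some i => single G i (c i).1 (c i).2
  | none, none => 0

theorem pairCorr_swap (G : SimpleGraph V) [DecidableRel G.Adj]
    (c : ∀ i : V, {j : V // G.Adj i j}) (x y : Option V) :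
    pairCorr G c x y = pairCorr G c y x := by
  rcases x with _ | i <;> rcases y with _ | j
  · rfl
  · rfl
  · rfl
  · by_cases h : G.Adj i j
    · simp only [pairCorr, dif_pos h, dif_pos h.symm, corr_swap G i j h]
    · simp only [pairCorr, dif_neg h, dif_neg (fun h' : G.Adj j i => h h'.symm)]

/-- The correlator attached to an edge of `∇G`. -/
def edgeCorr (G : SimpleGraph V) [DecidableRel G.Adj] (c : ∀ i : V, {j : V // G.Adj i j})
    (e : (suspension G).edgeSet) : (Event G → ℝ) →ₗ[ℝ] ℝ :=
  Sym2.lift ⟨pairCorr G c, pairCorr_swap G c⟩ e.1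

/-- The suspension-graph correspondence from behaviours on `G` to edge vectors of `∇G`:
`⟨M_i M_j⟩ = 1 - 2 x_{ij}` and `⟨M_i⟩ = 1 - 2 x_{iO}`. -/
def toCut (G : SimpleGraph V) [DecidableRel G.Adj] (c : ∀ i : V, {j : V // G.Adj i j})
    (P : Event G → ℝ) : (suspension G).edgeSet → ℝ :=
  fun e => (1 - edgeCorr G c e P) / 2

/-- The linear form `P ↦ ∑ -b_i b_j ⟨M_i M_j⟩` over the edges `{i,j}` of `∇G`, with `M_O` the
identity. -/
def correlatorForm (G : SimpleGraph V) [DecidableRel G.Adj] [Fintype (suspension G).edgeSet]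
    (c : ∀ i : V, {j : V // G.Adj i j}) (b : Option V → ℝ) : (Event G → ℝ) →ₗ[ℝ] ℝ :=
  ∑ e : (suspension G).edgeSet, (-((e : Sym2 (Option V)).map b).mul) • edgeCorr G c e

end Scenario

/-- The weights `b₁ = b₂ = b₃ = 1`, `b₄ = b₅ = -1` of the pentagonal inequality, the fifth vertex
of `K₅` being the suspension vertex `O = none`. -/
def pentagonWeight : Option (Fin 4) → ℝ
  | some i => ![1, 1, 1, -1] i
  | none => -1

end Contextuality

end

noncomputable section
namespace Contextuality

/-! Each pair correlator is affine in the cut coordinate of the corresponding edge of the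
suspension, with `O` acting as a measurement whose outcome is always `1`. An assignment `s`
therefore goes to the cut separating the outcomes `1` and `-1`. On `NC(G)` this map has an affine
left inverse, so facets of the cut polytope of `∇G` pull back to tight inequalities (`bijOn_toCut`,
`IsFacetDefining.of_affine_image`). The pentagonal form at a cut `S` equals `σ(1-σ)` with `σ =
∑_{i∈S} b_i` an integer. It is thus nonpositive, and nine independent cuts with `σ ∈ {0,1}` give the
facet.

There is no quantum violation because all pairs in `K₄` are compatible. The outcome projectors of
the four measurements commute and have a joint eigenbasis, so every quantum behaviour is a countable
or larger convex mixture of deterministic ones (`exists_hilbertBasis_deterministic`,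
`le_of_mem_quantumSet`).

The correlators are linear and vanish on constants. Subtracting the worst assignment `-b`, where `f
= -10`, from the constant behaviour and dividing by `3` thus gives a no-disturbance behaviour with
`f = 10/3`. Double counting over the 16 assignments shows that it obeys all exclusivity constraints,
and counting over the ten facet vertices shows that no such constraint cuts out the same face. -/

theorem suspension_adj_none {V : Type*} (G : SimpleGraph V) (i : V) : (suspension G).Adj (some i) none :=
  trivial

theorem suspension_adj_some {V : Type*} (G : SimpleGraph V) {i j : V} (h : G.Adj i j) :
    (suspension G).Adj (some i) (some j) :=
  h

/-! ### Affine correspondence between noncontextual and cut polytopes. -/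

section Scenario

variable {V : Type*} [LinearOrder V]

theorem exists_eq_ev (G : SimpleGraph V) (v : Event G) :
    ∃ i j, ∃ h : G.Adj i j, ∃ a b, v = ev G i j h a b := by
  obtain ⟨⟨⟨i, j⟩, hlt, h⟩, a, b⟩ := v
  exact ⟨i, j, h, a, b, by simp only [ev]; rw [dif_pos hlt]⟩

theorem deterministic_ev (G : SimpleGraph V) (s : V → ℤˣ) (i j : V) (h : G.Adj i j) (a b : ℤˣ) :
    deterministic G s (ev G i j h a b) = if s i = a ∧ s j = b then 1 else 0 := by
  unfold ev deterministic
  split_ifs <;> simp_all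

theorem sum_unitsInt {M : Type*} [AddCommMonoid M] (f : ℤˣ → M) : ∑ a, f a = f 1 + f (-1) := by
  rw [UnitsInt.univ, Finset.sum_pair (by decide)]

/-- The sign `±1` of an outcome as a real number. -/
def sign (a : ℤˣ) : ℝ := ((a : ℤ) : ℝ)

@[simp] theorem sign_one : sign 1 = 1 := by simp [sign]

@[simp] theorem sign_neg_one : sign (-1) = -1 := by simp [sign]

theorem corr_apply (G : SimpleGraph V) (i j : V) (h : G.Adj i j) (P : Event G → ℝ) :
    corr G i j h P = P (ev G i j h 1 1) - P (ev G i j h 1 (-1)) - P (ev G i j h (-1) 1)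
      + P (ev G i j h (-1) (-1)) := by
  simp [corr, show (1 : ℤˣ) ≠ -1 by decide, show (-1 : ℤˣ) ≠ 1 by decide]
  ring

theorem single_apply (G : SimpleGraph V) (i j : V) (h : G.Adj i j) (P : Event G → ℝ) :
    single G i j h P = P (ev G i j h 1 1) + P (ev G i j h 1 (-1)) - P (ev G i j h (-1) 1)
      - P (ev G i j h (-1) (-1)) := by
  simp [single]
  ring

theorem corr_deterministic (G : SimpleGraph V) (i j : V) (h : G.Adj i j) (s : V → ℤˣ) :
    corr G i j h (deterministic G s) = sign (s i) * sign (s j) := by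
  rw [corr_apply]
  simp only [deterministic_ev]
  rcases Int.units_eq_one_or (s i) with h1 | h1 <;> rcases Int.units_eq_one_or (s j) with h2 | h2 <;>
    simp [h1, h2, show (1 : ℤˣ) ≠ -1 by decide, show (-1 : ℤˣ) ≠ 1 by decide]

theorem single_deterministic (G : SimpleGraph V) (i j : V) (h : G.Adj i j) (s : V → ℤˣ) :
    single G i j h (deterministic G s) = sign (s i) := by
  rw [single_apply]
  simp only [deterministic_ev]
  rcases Int.units_eq_one_or (s i) with h1 | h1 <;> rcases Int.units_eq_one_or (s j) with h2 | h2 <;>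
    simp [h1, h2, show (1 : ℤˣ) ≠ -1 by decide, show (-1 : ℤˣ) ≠ 1 by decide]

/-- Extend an outcome assignment to the suspension vertex by the outcome `1`. -/
def extendOne (s : V → ℤˣ) : Option V → ℤˣ
  | some i => s i
  | none => 1

variable (G : SimpleGraph V) [DecidableRel G.Adj] (c : ∀ i : V, {j : V // G.Adj i j})

theorem pairCorr_deterministic (s : V → ℤˣ) (x y : Option V) (h : (suspension G).Adj x y) :
    pairCorr G c x y (deterministic G s) = sign (extendOne s x) * sign (extendOne s y) := by
  rcases x with _ | i <;> rcases y with _ | j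
  · exact h.elim
  · simp [pairCorr, single_deterministic, extendOne]
  · simp [pairCorr, single_deterministic, extendOne]
  · have h' : G.Adj i j := h
    simp [pairCorr, h', corr_deterministic, extendOne]

theorem cutVector_mk {W : Type*} (K : SimpleGraph W) (S : Set W) [DecidablePred (· ∈ S)]
    (i j : W) (h : K.Adj i j) :
    cutVector K S ⟨s(i, j), h⟩ = if (i ∈ S ↔ j ∈ S) then 0 else 1 := by
  unfold cutVector
  split_ifs with h1 h2 h2
  · obtain ⟨x, hx, y, hy, he⟩ := h1
    rcases Sym2.eq_iff.mp he with ⟨rfl, rfl⟩ | ⟨rfl, rfl⟩ <;> tauto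
  · rfl
  · rfl
  · refine absurd ?_ h1
    by_cases hi : i ∈ S
    · exact ⟨i, hi, j, by tauto, rfl⟩
    · exact ⟨j, by tauto, i, hi, Sym2.eq_swap⟩

theorem toCut_deterministic (s : V → ℤˣ) :
    toCut G c (deterministic G s) = cutVector (suspension G) {x | extendOne s x = -1} := by
  funext ⟨e, he⟩
  induction e using Sym2.ind with
  | _ x y =>
    rw [cutVector_mk _ _ _ _ he]
    have : edgeCorr G c ⟨s(x, y), he⟩ = pairCorr G c x y := rfl
    simp only [toCut, this, pairCorr_deterministic G c s x y he, Set.mem_ofPred_eq]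
    rcases Int.units_eq_one_or (extendOne s x) with h1 | h1 <;>
      rcases Int.units_eq_one_or (extendOne s y) with h2 | h2 <;>
      simp [h1, h2, show (1 : ℤˣ) ≠ -1 by decide]

/-- A set and its complement give the same cut, so the side containing `O` may be labelled `1`. This
is what makes every cut come from an assignment. -/
theorem toCut_image_range_deterministic :
    toCut G c '' Set.range (deterministic G) = Set.range (cutVector (suspension G)) := by
  classical
  apply Set.Subset.antisymm
  · rintro _ ⟨_, ⟨s, rfl⟩, rfl⟩
    exact ⟨_, (toCut_deterministic G c s).symm⟩
  · rintro _ ⟨S, rfl⟩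
    refine ⟨_, ⟨fun i => if (some i ∈ S ↔ none ∈ S) then 1 else -1, rfl⟩, ?_⟩
    rw [toCut_deterministic]
    funext ⟨e, he⟩
    induction e using Sym2.ind with
    | _ x y =>
      rw [cutVector_mk _ _ _ _ he, cutVector_mk _ _ _ _ he]
      have key : ∀ z, z ∈ {x | extendOne (fun i => if (some i ∈ S ↔ none ∈ S) then (1 : ℤˣ) else -1)
          x = -1} ↔ ¬ (z ∈ S ↔ none ∈ S) := by
        rintro (_ | z)
        · simp [extendOne, show (1 : ℤˣ) ≠ -1 by decide]
        · by_cases hz : (some z ∈ S ↔ none ∈ S) <;>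
            simp [extendOne, hz, show (1 : ℤˣ) ≠ -1 by decide]
      simp only [key]
      by_cases hx : x ∈ S <;> by_cases hy : y ∈ S <;> by_cases hz : none ∈ S <;> simp [hx, hy, hz]

/-- The correspondence `toCut` as an affine map. -/
def toCutAffine : (Event G → ℝ) →ᵃ[ℝ] ((suspension G).edgeSet → ℝ) :=
  AffineMap.const ℝ (Event G → ℝ) (fun _ : (suspension G).edgeSet => (1 / 2 : ℝ)) -
    ((1 / 2 : ℝ) • LinearMap.pi (φ := fun _ : (suspension G).edgeSet => ℝ)
      (fun e => edgeCorr G c e)).toAffineMap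

theorem toCutAffine_apply (P : Event G → ℝ) : toCutAffine G c P = toCut G c P := by
  funext e
  simp [toCutAffine, toCut]
  ring

/-- The affine left inverse of `toCut` on no-disturbance behaviours,
`P(ab|ij) = (1 + a⟨M_i⟩ + b⟨M_j⟩ + ab⟨M_i M_j⟩) / 4`. -/
def ofCut : ((suspension G).edgeSet → ℝ) →ᵃ[ℝ] (Event G → ℝ) :=
  AffineMap.const ℝ ((suspension G).edgeSet → ℝ) (fun v : Event G => (1 + sign v.2.1 + sign v.2.2 + sign v.2.1 * sign v.2.2) / 4) -
    ((1 / 2 : ℝ) • LinearMap.pi (φ := fun _ : Event G => ℝ) (fun v : Event G =>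
      sign v.2.1 • LinearMap.proj (R := ℝ) (φ := fun _ : (suspension G).edgeSet => ℝ)
        ⟨s(some v.1.1.1, none), suspension_adj_none G v.1.1.1⟩ +
      sign v.2.2 • LinearMap.proj (R := ℝ) (φ := fun _ : (suspension G).edgeSet => ℝ)
        ⟨s(some v.1.1.2, none), suspension_adj_none G v.1.1.2⟩ +
      (sign v.2.1 * sign v.2.2) •
        LinearMap.proj (R := ℝ) (φ := fun _ : (suspension G).edgeSet => ℝ)
        ⟨s(some v.1.1.1, some v.1.1.2), suspension_adj_some G v.1.2.2⟩)).toAffineMap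

theorem ofCut_toCutAffine {P : Event G → ℝ} (hP : P ∈ ncPolytope G) :
    ofCut G (toCutAffine G c P) = P := by
  classical
  -- The fixed points of an affine map form a convex set, so the identity need only be checked at
  -- deterministic behaviours.
  have hconv : Convex ℝ {P | ofCut G (toCutAffine G c P) = P} := by
    intro x hx y hy a b _ _ hab
    have hx' : ((ofCut G).comp (toCutAffine G c)) x = x := hx
    have hy' : ((ofCut G).comp (toCutAffine G c)) y = y := hy
    change ((ofCut G).comp (toCutAffine G c)) (a • x + b • y) = _
    rw [Convex.combo_affine_apply hab, hx', hy']
  refine convexHull_min ?_ hconv hP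
  rintro _ ⟨s, rfl⟩
  rw [Set.mem_ofPred_eq, toCutAffine_apply, toCut_deterministic]
  funext ⟨⟨⟨i, j⟩, hlt, h⟩, a, b⟩
  simp only [ofCut, deterministic, AffineMap.coe_sub, AffineMap.coe_const, Pi.sub_apply,
    Function.const_apply, LinearMap.coe_toAffineMap, LinearMap.smul_apply, Pi.smul_apply,
    LinearMap.pi_apply, LinearMap.add_apply, LinearMap.proj_apply, smul_eq_mul]
  rw [cutVector_mk _ _ _ _ (suspension_adj_none G i), cutVector_mk _ _ _ _ (suspension_adj_none G j),
    cutVector_mk _ _ _ _ (suspension_adj_some G h)]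
  simp only [Set.mem_ofPred_eq, extendOne]
  rcases Int.units_eq_one_or (s i) with h1 | h1 <;>
    rcases Int.units_eq_one_or (s j) with h2 | h2 <;>
    rcases Int.units_eq_one_or a with h3 | h3 <;>
    rcases Int.units_eq_one_or b with h4 | h4 <;>
    simp [h1, h2, h3, h4, show (1 : ℤˣ) ≠ -1 by decide, show (-1 : ℤˣ) ≠ 1 by decide] <;> norm_num

theorem toCutAffine_image_ncPolytope :
    toCutAffine G c '' ncPolytope G = cutPolytope (suspension G) := by
  rw [ncPolytope, AffineMap.image_convexHull, cutPolytope, ← toCut_image_range_deterministic G c]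
  simp only [funext (toCutAffine_apply G c)]

theorem bijOn_toCut : Set.BijOn (toCut G c) (ncPolytope G) (cutPolytope (suspension G)) := by
  rw [← toCutAffine_image_ncPolytope G c, ← funext (toCutAffine_apply G c)]
  refine Set.InjOn.bijOn_image fun P hP Q hQ h => ?_
  rw [← ofCut_toCutAffine G c hP, ← ofCut_toCutAffine G c hQ, h]

end Scenario

/-! ### Transport of facets along affine maps. -/

theorem finrank_vectorSpan_image_of_leftInvOn {E F : Type*} [AddCommGroup E] [Module ℝ E]
    [AddCommGroup F] [Module ℝ F] [FiniteDimensional ℝ E] [FiniteDimensional ℝ F]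
    (A : E →ᵃ[ℝ] F) (B : F →ᵃ[ℝ] E) {X : Set E} (h : ∀ p ∈ X, B (A p) = p) :
    Module.finrank ℝ (vectorSpan ℝ (A '' X)) = Module.finrank ℝ (vectorSpan ℝ X) := by
  -- An affine map cannot raise dimension; `A` and `B` carry `X` and its image onto each other.
  have hX : B '' (A '' X) = X := by
    rw [← Set.image_comp]
    exact (Set.image_congr (g := id) h).trans (Set.image_id X)
  apply le_antisymm
  · rw [← AffineMap.map_vectorSpan]
    exact Submodule.finrank_map_le _ _
  · conv_lhs => rw [← hX]
    rw [← AffineMap.map_vectorSpan]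
    exact Submodule.finrank_map_le _ _

/-- Facets pull back along affine maps that are injective with an affine left inverse. -/
theorem IsFacetDefining.of_affine_image {E F : Type*} [AddCommGroup E] [Module ℝ E]
    [AddCommGroup F] [Module ℝ F] [FiniteDimensional ℝ E] [FiniteDimensional ℝ F]
    (A : E →ᵃ[ℝ] F) (B : F →ᵃ[ℝ] E) {X : Set E} (h : ∀ p ∈ X, B (A p) = p)
    {g : F →ₗ[ℝ] ℝ} {β : ℝ} {f : E →ₗ[ℝ] ℝ} {γ k : ℝ} (hk : 0 < k)
    (hfg : ∀ p ∈ X, g (A p) - β = k * (f p - γ)) (hg : IsFacetDefining g β (A '' X)) :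
    IsFacetDefining f γ X := by
  have hface : {q ∈ A '' X | g q = β} = A '' {p ∈ X | f p = γ} := by
    ext q
    constructor
    · rintro ⟨⟨p, hp, rfl⟩, hq⟩
      refine ⟨p, ⟨hp, ?_⟩, rfl⟩
      have := hfg p hp
      rw [hq, sub_self, eq_comm, mul_eq_zero] at this
      exact sub_eq_zero.mp (this.resolve_left hk.ne')
    · rintro ⟨p, ⟨hp, hq⟩, rfl⟩
      refine ⟨⟨p, hp, rfl⟩, ?_⟩
      have := hfg p hp
      rw [hq, sub_self, mul_zero] at this
      exact sub_eq_zero.mp this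
  obtain ⟨h1, h2, h3⟩ := hg
  refine ⟨fun p hp => ?_, ?_, ?_⟩
  · have h4 := hfg p hp
    have h5 := h1 _ ⟨p, hp, rfl⟩
    by_contra! h6
    have := mul_pos hk (sub_pos.mpr h6)
    linarith
  · rw [hface] at h2
    exact Set.image_nonempty.mp h2
  · rw [hface, finrank_vectorSpan_image_of_leftInvOn A B h,
      finrank_vectorSpan_image_of_leftInvOn A B (fun p hp => h p hp.1)] at h3
    exact h3

/-! ### The pentagonal facet of the cut polytope of `K₅`. -/

theorem suspension_top {V : Type*} : suspension (⊤ : SimpleGraph V) = ⊤ := by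
  ext x y
  rcases x with _ | i <;> rcases y with _ | j <;> simp [suspension, suspensionAdj]

/-- A sum over the ten edges of `K₅`. -/
theorem sum_edgeSet_of_eq_top {K : SimpleGraph (Option (Fin 4))} [Fintype K.edgeSet] (hK : K = ⊤)
    (F : Sym2 (Option (Fin 4)) → ℝ) :
    ∑ e : K.edgeSet, F e =
      F s(some 0, some 1) + F s(some 0, some 2) + F s(some 1, some 2) + F s(some 0, some 3)
      + F s(some 1, some 3) + F s(some 2, some 3) + F s(some 0, none) + F s(some 1, none)
      + F s(some 2, none) + F s(some 3, none) := by
  have h : (⊤ : SimpleGraph (Option (Fin 4))).edgeFinset =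
      {s(some 0, some 1), s(some 0, some 2), s(some 1, some 2), s(some 0, some 3),
      s(some 1, some 3), s(some 2, some 3), s(some 0, none), s(some 1, none),
      s(some 2, none), s(some 3, none)} := by decide
  rw [Finset.sum_set_coe, show K.edgeSet.toFinset = _ from
    (Finset.ext fun e => by rw [Set.mem_toFinset, SimpleGraph.mem_edgeFinset, hK]).trans h]
  repeat rw [Finset.sum_insert (by decide)]
  rw [Finset.sum_singleton]
  ring

theorem mem_cutPolytope {W : Type*} (K : SimpleGraph W) (S : Set W) :
    cutVector K S ∈ cutPolytope K :=
  subset_convexHull ℝ _ ⟨S, rfl⟩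

-- The sum of `b_i b_j` over pairs separated by `S` is `σ(B - σ)`, where `σ` is the weight of `S`
-- and `B = 1` is the total weight.
open Classical in
theorem edgeForm_pentagonWeight_apply {K : SimpleGraph (Option (Fin 4))} [Fintype K.edgeSet]
    (hK : K = ⊤) (S : Set (Option (Fin 4))) :
    edgeForm K pentagonWeight (cutVector K S) =
      (∑ i, if i ∈ S then pentagonWeight i else 0) *
        (1 - ∑ i, if i ∈ S then pentagonWeight i else 0) := by
  -- Extending the summand to all unordered pairs makes it independent of edge-membership proofs, as
  -- the ten-term expansion requires.
  let F : Sym2 (Option (Fin 4)) → ℝ := fun e =>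
    (e.map pentagonWeight).mul * if ∃ i ∈ S, ∃ j ∉ S, e = s(i, j) then 1 else 0
  have hF : ∀ i j, F s(i, j) =
      pentagonWeight i * pentagonWeight j * if (i ∈ S ↔ j ∈ S) then 0 else 1 := by
    intro i j
    by_cases h : i = j
    · subst h
      have : ¬ ∃ x ∈ S, ∃ y ∉ S, s(i, i) = s(x, y) := by
        rintro ⟨x, hx, y, hy, he⟩
        rcases Sym2.eq_iff.mp he with ⟨rfl, rfl⟩ | ⟨rfl, rfl⟩ <;> exact hy hx
      simp only [F, if_neg this, iff_self, if_true, mul_zero]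
    · rw [← cutVector_mk ⊤ S i j h]
      simp only [F, cutVector, Sym2.map_mk, Sym2.mul_mk]
      congr!
  have : edgeForm K pentagonWeight (cutVector K S) = ∑ e : K.edgeSet, F e := by
    simp [edgeForm, F, cutVector]
  rw [this, sum_edgeSet_of_eq_top hK]
  simp only [hF, Fintype.sum_option, Fin.sum_univ_four, pentagonWeight]
  by_cases h0 : some 0 ∈ S <;> by_cases h1 : some 1 ∈ S <;> by_cases h2 : some 2 ∈ S <;>
    by_cases h3 : some 3 ∈ S <;> by_cases h4 : none ∈ S <;>
    simp [h0, h1, h2, h3, h4] <;> norm_num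

/-- A linear form `f` that is nonpositive on `P`, vanishes on `n` linearly independent vectors of `P`
and at `0 ∈ P`, and is nonzero at a further point of `P`, defines a facet if `n + 1` is the dimension
of the ambient space. -/
theorem isFacetDefining_of_linearIndependent {E : Type*} [AddCommGroup E] [Module ℝ E]
    [FiniteDimensional ℝ E] {f : E →ₗ[ℝ] ℝ} {P : Set E} {n : ℕ} (hn : Module.finrank ℝ E ≤ n + 1)
    (hf : ∀ p ∈ P, f p ≤ 0) (h0 : (0 : E) ∈ P) (w : Fin n → E) (hw : LinearIndependent ℝ w)
    (hwP : ∀ k, w k ∈ P) (hw0 : ∀ k, f (w k) = 0) {q : E} (hq : q ∈ P) (hfq : f q ≠ 0) :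
    IsFacetDefining f 0 P := by
  have h0' : (0 : E) ∈ {p ∈ P | f p = 0} := ⟨h0, map_zero f⟩
  refine ⟨hf, ⟨0, h0'⟩, ?_⟩
  have hle : vectorSpan ℝ {p ∈ P | f p = 0} ≤ vectorSpan ℝ P :=
    vectorSpan_mono ℝ (Set.sep_subset _ _)
  have hker : vectorSpan ℝ {p ∈ P | f p = 0} ≤ LinearMap.ker f := by
    refine Submodule.span_le.mpr ?_
    rintro _ ⟨x, hx, y, hy, rfl⟩
    simp [hx.2, hy.2]
  have hqP : q ∈ vectorSpan ℝ P := by simpa using vsub_mem_vectorSpan ℝ hq h0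
  have hlt : vectorSpan ℝ {p ∈ P | f p = 0} < vectorSpan ℝ P :=
    lt_of_le_of_ne hle fun h => hfq (hker (h ▸ hqP))
  have hspan : Submodule.span ℝ (Set.range w) ≤ vectorSpan ℝ {p ∈ P | f p = 0} := by
    refine Submodule.span_le.mpr ?_
    rintro _ ⟨k, rfl⟩
    have := vsub_mem_vectorSpan ℝ (s := {p ∈ P | f p = 0}) ⟨hwP k, hw0 k⟩ h0'
    simpa using this
  have h1 := Submodule.finrank_mono hspan
  rw [finrank_span_eq_card hw, Fintype.card_fin] at h1
  have h2 := Submodule.finrank_lt_finrank_of_lt hlt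
  have h3 := Submodule.finrank_le (vectorSpan ℝ P)
  omega

/-- Nine cuts of `K₅` at which the pentagonal inequality is tight. -/
def pentagonRoots : Fin 9 → Finset (Option (Fin 4)) :=
  ![{some 0, some 3}, {some 1, some 3}, {some 2, some 3}, {some 0, none}, {some 1, none},
    {some 2, none}, {some 0}, {some 1}, {some 2}]

theorem linearIndependent_pentagonRoots :
    LinearIndependent ℝ fun k => cutVector (⊤ : SimpleGraph (Option (Fin 4)))
      (pentagonRoots k : Set (Option (Fin 4))) := by
  rw [Fintype.linearIndependent_iff]
  intro g hg
  -- Each edge of `K₅` gives one linear equation in the nine coefficients; the ten equations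
  -- together force them all to vanish.
  have key : ∀ i j : Option (Fin 4), i ≠ j →
      ∑ k, g k * (if (i ∈ pentagonRoots k ↔ j ∈ pentagonRoots k) then 0 else 1) = 0 := by
    intro i j h
    have := congrFun hg ⟨s(i, j), h⟩
    simp only [Finset.sum_apply, Pi.smul_apply, smul_eq_mul, Pi.zero_apply] at this
    refine (Finset.sum_congr rfl fun k _ => ?_).trans this
    rw [cutVector_mk ⊤ _ i j h]
    simp
  have e1 := key (some 0) (some 1) (by decide)
  have e2 := key (some 0) (some 2) (by decide)
  have e3 := key (some 1) (some 2) (by decide)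
  have e4 := key (some 0) (some 3) (by decide)
  have e5 := key (some 1) (some 3) (by decide)
  have e6 := key (some 2) (some 3) (by decide)
  have e7 := key (some 0) none (by decide)
  have e8 := key (some 1) none (by decide)
  have e9 := key (some 2) none (by decide)
  have e10 := key (some 3) none (by decide)
  simp [Fin.sum_univ_succ, pentagonRoots] at e1 e2 e3 e4 e5 e6 e7 e8 e9 e10
  intro k
  fin_cases k <;> simp <;> linarith

theorem edgeForm_pentagonWeight_nonpos {K : SimpleGraph (Option (Fin 4))} [Fintype K.edgeSet]
    (hK : K = ⊤) {x : K.edgeSet → ℝ} (hx : x ∈ cutPolytope K) :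
    edgeForm K pentagonWeight x ≤ 0 := by
  classical
  refine convexHull_min ?_ (convex_halfSpace_le (edgeForm K pentagonWeight).isLinear 0) hx
  rintro _ ⟨S, rfl⟩
  rw [Set.mem_ofPred_eq, edgeForm_pentagonWeight_apply hK]
  simp only [Fintype.sum_option, Fin.sum_univ_four, pentagonWeight]
  split_ifs <;> simp <;> norm_num

theorem isFacetDefining_pentagon {K : SimpleGraph (Option (Fin 4))} [Fintype K.edgeSet]
    (hK : K = ⊤) : IsFacetDefining (edgeForm K pentagonWeight) 0 (cutPolytope K) := by
  have hcard : Fintype.card K.edgeSet ≤ 9 + 1 := by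
    have := sum_edgeSet_of_eq_top hK (fun _ => 1)
    simp only [Finset.sum_const, Finset.card_univ, nsmul_eq_mul, mul_one] at this
    have h : (Fintype.card K.edgeSet : ℝ) ≤ (9 + 1 : ℕ) := by rw [this]; norm_num
    exact_mod_cast h
  -- The ambient dimension is at most 10, so nine roots suffice. The cut `{some 3}` has `σ = -1` and
  -- value `-2`, so it lies off the face.
  refine isFacetDefining_of_linearIndependent (n := 9) (by simpa using hcard)
    (fun p hp => edgeForm_pentagonWeight_nonpos hK hp) ?_
    (fun k => cutVector K (pentagonRoots k : Set (Option (Fin 4)))) ?_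
    (fun k => mem_cutPolytope K _) ?_ (mem_cutPolytope K {some 3}) ?_
  · convert mem_cutPolytope K ∅
    funext e
    simp [cutVector]
  · subst hK
    exact linearIndependent_pentagonRoots
  · intro k
    rw [edgeForm_pentagonWeight_apply hK]
    fin_cases k <;> simp [pentagonRoots, Fintype.sum_option, Fin.sum_univ_four, pentagonWeight]
  · rw [edgeForm_pentagonWeight_apply hK]
    simp [pentagonWeight]

/-! ### The pentagonal inequality as a tight noncontextuality inequality. -/

variable (c : ∀ i : Fin 4, {j : Fin 4 // (⊤ : SimpleGraph (Fin 4)).Adj i j})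

theorem edgeForm_toCut (P : Event (⊤ : SimpleGraph (Fin 4)) → ℝ) :
    edgeForm (suspension (⊤ : SimpleGraph (Fin 4))) pentagonWeight (toCut ⊤ c P) =
      (correlatorForm ⊤ c pentagonWeight P - 2) / 2 := by
  have h := sum_edgeSet_of_eq_top (suspension_top (V := Fin 4))
    (fun e => (e.map pentagonWeight).mul)
  -- The constant is `((∑ b_i)² - ∑ b_i²)/2 = (1 - 5)/2`.
  have h2 : ∑ e : (suspension (⊤ : SimpleGraph (Fin 4))).edgeSet,
      (Sym2.map pentagonWeight e).mul = -2 := by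
    rw [h]
    simp [pentagonWeight]
    norm_num
  have h3 : correlatorForm ⊤ c pentagonWeight P - 2 =
      ∑ e : (suspension (⊤ : SimpleGraph (Fin 4))).edgeSet,
        (-((Sym2.map pentagonWeight e).mul * edgeCorr ⊤ c e P) +
          (Sym2.map pentagonWeight e).mul) := by
    rw [Finset.sum_add_distrib, h2]
    simp [correlatorForm]
    ring
  rw [h3, Finset.sum_div]
  simp only [edgeForm, LinearMap.sum_apply, LinearMap.smul_apply, LinearMap.proj_apply,
    smul_eq_mul, toCut]
  exact Finset.sum_congr rfl fun e _ => by ring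

theorem isFacetDefining_correlatorForm :
    IsFacetDefining (correlatorForm (⊤ : SimpleGraph (Fin 4)) c pentagonWeight) 2
      (ncPolytope ⊤) := by
  refine IsFacetDefining.of_affine_image (toCutAffine ⊤ c) (ofCut ⊤)
    (fun p hp => ofCut_toCutAffine ⊤ c hp) (k := 1 / 2) (by norm_num) (fun p _ => ?_)
    (toCutAffine_image_ncPolytope ⊤ c ▸ isFacetDefining_pentagon suspension_top)
  rw [toCutAffine_apply, edgeForm_toCut]
  ring

-- With `s_O = 1`, expanding `(∑ b_i s_i)²` leaves five diagonal ones and twice the pair sum; the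
-- final `-1` in the square is the term of `O`.
open Classical in
theorem correlatorForm_deterministic (s : Fin 4 → ℤˣ) :
    correlatorForm ⊤ c pentagonWeight (deterministic ⊤ s) =
      (5 - (sign (s 0) + sign (s 1) + sign (s 2) - sign (s 3) - 1) ^ 2) / 2 := by
  have h := edgeForm_toCut c (deterministic ⊤ s)
  rw [toCut_deterministic, edgeForm_pentagonWeight_apply suspension_top] at h
  rw [eq_div_iff two_ne_zero, eq_sub_iff_add_eq] at h
  rw [← h]
  simp only [Fintype.sum_option, Fin.sum_univ_four, pentagonWeight, Set.mem_ofPred_eq, extendOne]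
  rcases Int.units_eq_one_or (s 0) with h0 | h0 <;> rcases Int.units_eq_one_or (s 1) with h1 | h1 <;>
    rcases Int.units_eq_one_or (s 2) with h2 | h2 <;>
    rcases Int.units_eq_one_or (s 3) with h3 | h3 <;>
    simp [h0, h1, h2, h3, show (1 : ℤˣ) ≠ -1 by decide] <;> norm_num

end Contextuality
end

/-! ### Exclusivity and the algebra of outcome projectors. -/

noncomputable section
namespace Contextuality

section Scenario

variable {V : Type*} [LinearOrder V]

/-- Two events conflict if they assign different outcomes to a common measurement. -/
def Conflict {G : SimpleGraph V} (u v : Event G) : Prop :=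
  (u.1.1.1 = v.1.1.1 ∧ u.2.1 ≠ v.2.1) ∨ (u.1.1.1 = v.1.1.2 ∧ u.2.1 ≠ v.2.2) ∨
    (u.1.1.2 = v.1.1.1 ∧ u.2.2 ≠ v.2.1) ∨ (u.1.1.2 = v.1.1.2 ∧ u.2.2 ≠ v.2.2)

theorem conflict_ev (G : SimpleGraph V) {i j k : V} (hj : G.Adj i j) (hk : G.Adj i k)
    {a a' : ℤˣ} (b b' : ℤˣ) (h : a ≠ a') : Conflict (ev G i j hj a b) (ev G i k hk a' b') := by
  unfold ev Conflict
  split_ifs <;> simp [h]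

theorem Conflict.ne {G : SimpleGraph V} {u v : Event G} (h : Conflict u v) : u ≠ v := by
  rintro rfl
  rcases h with h | h | h | h
  · exact h.2 rfl
  · exact u.1.2.1.ne h.1
  · exact u.1.2.1.ne' h.1
  · exact h.2 rfl

theorem conflict_ev_of_ne (G : SimpleGraph V) {i j : V} (h : G.Adj i j) {a b a' b' : ℤˣ}
    (hne : ev G i j h a b ≠ ev G i j h a' b') : Conflict (ev G i j h a b) (ev G i j h a' b') := by
  by_cases ha : a = a'
  · rw [← ev_swap G i j h a b, ← ev_swap G i j h a' b']
    refine conflict_ev G _ _ _ _ fun hb => hne (by rw [ha, hb])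
  · exact conflict_ev G _ _ _ _ ha

/-- Distinct outcomes of one context differ at some measurement, and the two branches of a protocol
differ at its first one. -/
theorem Orthogonal.conflict {G : SimpleGraph V} {u v : Event G} (h : Orthogonal G u v) :
    Conflict u v := by
  obtain ⟨hne, e, he, hu, hv⟩ := h
  rcases he with ⟨i, j, hij, rfl⟩ | ⟨i, j, k, hj, hk, rfl⟩
  · simp only [contextEdge, Finset.mem_image, Finset.mem_univ, true_and] at hu hv
    obtain ⟨p, rfl⟩ := hu
    obtain ⟨q, rfl⟩ := hv
    exact conflict_ev_of_ne G hij hne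
  · simp only [protocolEdge, Finset.mem_union, Finset.mem_image, Finset.mem_univ, true_and] at hu hv
    obtain ⟨p, rfl⟩ | ⟨p, rfl⟩ := hu <;> obtain ⟨q, rfl⟩ | ⟨q, rfl⟩ := hv
    · exact conflict_ev_of_ne G hj hne
    · exact conflict_ev G _ _ _ _ (by decide)
    · exact conflict_ev G _ _ _ _ (by decide)
    · exact conflict_ev_of_ne G hk hne

theorem orthogonal_ev_of_ne (G : SimpleGraph V) {i j : V} (h : G.Adj i j) {a b a' b' : ℤˣ}
    (hne : a ≠ a' ∨ b ≠ b') : Orthogonal G (ev G i j h a b) (ev G i j h a' b') := by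
  refine ⟨?_, contextEdge G i j h, Or.inl ⟨i, j, h, rfl⟩,
    Finset.mem_image_of_mem (fun ab : ℤˣ × ℤˣ => ev G i j h ab.1 ab.2) (Finset.mem_univ (a, b)),
    Finset.mem_image_of_mem (fun ab : ℤˣ × ℤˣ => ev G i j h ab.1 ab.2) (Finset.mem_univ (a', b'))⟩
  rcases hne with hne | hne
  · exact (conflict_ev G h h b b' hne).ne
  · rw [← ev_swap G i j h a b, ← ev_swap G i j h a' b']
    exact (conflict_ev G h.symm h.symm a a' hne).ne

theorem deterministic_eq_zero_or_one (G : SimpleGraph V) (s : V → ℤˣ) (v : Event G) :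
    deterministic G s v = 0 ∨ deterministic G s v = 1 := by
  unfold deterministic
  split_ifs <;> simp

theorem Conflict.deterministic_mul {G : SimpleGraph V} {u v : Event G} (h : Conflict u v)
    (s : V → ℤˣ) : deterministic G s u * deterministic G s v = 0 := by
  unfold deterministic
  split_ifs with h1 h2 <;> simp
  rcases h with h | h | h | h <;> apply h.2
  · rw [← h1.1, ← h2.1, h.1]
  · rw [← h1.1, ← h2.2, h.1]
  · rw [← h1.2, ← h2.1, h.1]
  · rw [← h1.2, ← h2.2, h.1]

/-- Deterministic behaviours satisfy Consistent Exclusivity. -/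
theorem satisfiesCE_deterministic (G : SimpleGraph V) (s : V → ℤˣ) :
    SatisfiesCE G (deterministic G s) := by
  intro S hS
  by_cases h : ∃ u ∈ S, deterministic G s u = 1
  · obtain ⟨u, hu, h1⟩ := h
    rw [Finset.sum_eq_single_of_mem u hu, h1]
    intro v hv hvu
    have := (hS hv hu hvu).conflict.deterministic_mul s
    rwa [h1, mul_one] at this
  · push Not at h
    rw [Finset.sum_eq_zero]
    · norm_num
    · exact fun v hv => (deterministic_eq_zero_or_one G s v).resolve_right (h v hv)

/-! ### Projectors of outcomes -/

variable {G : SimpleGraph V} {A : Type*} [Ring A] {Q : Event G → A}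

theorem sum_contextEdge {M : Type*} [AddCommMonoid M] (F : Event G → M) {i j : V}
    (h : G.Adj i j) : ∑ v ∈ contextEdge G i j h, F v = ∑ a, ∑ b, F (ev G i j h a b) := by
  rw [contextEdge, Finset.sum_image, ← Finset.univ_product_univ, Finset.sum_product]
  rintro ⟨a, b⟩ - ⟨a', b'⟩ - he
  by_contra hne
  refine (orthogonal_ev_of_ne G h (a := a) (b := b) (a' := a') (b' := b') ?_).1 he
  by_contra! h'
  exact hne (Prod.ext h'.1 h'.2)

theorem sum_protocolEdge {M : Type*} [AddCommMonoid M] (F : Event G → M) {i j k : V}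
    (hj : G.Adj i j) (hk : G.Adj i k) : ∑ v ∈ protocolEdge G i j k hj hk, F v =
      ∑ b, F (ev G i j hj (-1) b) + ∑ b, F (ev G i k hk 1 b) := by
  rw [protocolEdge, Finset.sum_union, Finset.sum_image, Finset.sum_image]
  · intro b _ b' _ he
    by_contra hne
    exact (orthogonal_ev_of_ne G hk (Or.inr hne)).1 he
  · intro b _ b' _ he
    by_contra hne
    exact (orthogonal_ev_of_ne G hj (Or.inr hne)).1 he
  · rw [Finset.disjoint_left]
    simp only [Finset.mem_image, Finset.mem_univ, true_and]
    rintro _ ⟨b, rfl⟩ ⟨b', he⟩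
    exact (conflict_ev G hk hj b' b (show (1 : ℤˣ) ≠ -1 by decide)).ne he

/-- The marginal `∑ b, Q (ab|ij)` of a family that sums to `1` on hyperedges does not depend
on `j`. -/
theorem marginal_eq (hQ : ∀ e, IsHyperedge G e → ∑ v ∈ e, Q v = 1) {i j k : V} (hj : G.Adj i j)
    (hk : G.Adj i k) (a : ℤˣ) : ∑ b, Q (ev G i j hj a b) = ∑ b, Q (ev G i k hk a b) := by
  -- Protocols that share one branch but continue differently on the other force the differing
  -- branches to have equal sums.
  have h1 := hQ _ (Or.inr ⟨i, j, k, hj, hk, rfl⟩)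
  have h2 := hQ _ (Or.inr ⟨i, k, k, hk, hk, rfl⟩)
  have h3 := hQ _ (Or.inr ⟨i, j, j, hj, hj, rfl⟩)
  rw [sum_protocolEdge] at h1 h2 h3
  rcases Int.units_eq_one_or a with rfl | rfl
  · exact add_left_cancel (h3.trans h1.symm)
  · exact add_right_cancel (h1.trans h2.symm)

theorem sum_marginal (hQ : ∀ e, IsHyperedge G e → ∑ v ∈ e, Q v = 1) {i j : V} (h : G.Adj i j) :
    ∑ a, ∑ b, Q (ev G i j h a b) = 1 := by
  rw [← sum_contextEdge]
  exact hQ _ (Or.inl ⟨i, j, h, rfl⟩)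

/-- Within one context only the event `(ab|ij)` occurs in both marginals; all cross terms are
products of orthogonal events. -/
theorem marginal_mul_marginal (hidem : ∀ v, IsIdempotentElem (Q v))
    (horth : ∀ u v, Orthogonal G u v → Q u * Q v = 0) {i j : V} (h : G.Adj i j) (a b : ℤˣ) :
    (∑ b', Q (ev G i j h a b')) * (∑ a', Q (ev G j i h.symm b a')) = Q (ev G i j h a b) := by
  simp only [fun a' => ev_swap G i j h a' b]
  rw [Finset.sum_mul_sum, Finset.sum_eq_single b, Finset.sum_eq_single a]
  · exact hidem _
  · exact fun a' _ ha' => horth _ _ (orthogonal_ev_of_ne G h (Or.inl ha'.symm))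
  · exact fun hn => absurd (Finset.mem_univ _) hn
  · exact fun b' _ hb' => Finset.sum_eq_zero fun a' _ =>
      horth _ _ (orthogonal_ev_of_ne G h (Or.inr hb'))
  · exact fun hn => absurd (Finset.mem_univ _) hn

theorem marginal_mul_self (hidem : ∀ v, IsIdempotentElem (Q v))
    (horth : ∀ u v, Orthogonal G u v → Q u * Q v = 0) {i j : V} (h : G.Adj i j) (a a' : ℤˣ) :
    (∑ b, Q (ev G i j h a b)) * (∑ b, Q (ev G i j h a' b)) =
      if a = a' then ∑ b, Q (ev G i j h a b) else 0 := by
  rw [Finset.sum_mul_sum]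
  split_ifs with ha
  · subst ha
    refine Finset.sum_congr rfl fun b _ => ?_
    rw [Finset.sum_eq_single b, hidem _]
    · exact fun b' _ hb' => horth _ _ (orthogonal_ev_of_ne G h (Or.inr hb'.symm))
    · exact fun hn => absurd (Finset.mem_univ _) hn
  · exact Finset.sum_eq_zero fun b _ => Finset.sum_eq_zero fun b' _ =>
      horth _ _ (orthogonal_ev_of_ne G h (Or.inl ha))

end Scenario

end Contextuality
end

/-! ### Joint diagonalization and the absence of quantum violations. -/

noncomputable section
namespace Contextuality

/-- Hilbert bases of the ranges of the `E s` are glued together. A vector orthogonal to all of them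
is killed by every `E s`, hence by their sum `1`. -/
theorem exists_hilbertBasis_of_sum_projections {H : Type w} [NormedAddCommGroup H]
    [InnerProductSpace ℂ H] [CompleteSpace H] {σ : Type} [Fintype σ] (E : σ → H →L[ℂ] H)
    (hE : ∀ s, IsSelfAdjoint (E s)) (horth : ∀ s t, s ≠ t → E s * E t = 0)
    (hsum : ∑ s, E s = 1) :
    ∃ (ι : Type w) (e : HilbertBasis ι ℂ H) (k : ι → σ), ∀ i, E (k i) (e i) = e i := by
  classical
  have hsym : ∀ s x y, inner ℂ (E s x) y = inner ℂ x (E s y) := fun s =>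
    ContinuousLinearMap.isSelfAdjoint_iff_isSymmetric.mp (hE s)
  let K : σ → Submodule ℂ H := fun s => LinearMap.ker ((E s - 1 : H →L[ℂ] H) : H →ₗ[ℂ] H)
  have hK : ∀ s x, x ∈ K s ↔ E s x = x := fun s x => by simp [K, sub_eq_zero]
  have hcomplete : ∀ s, CompleteSpace (K s) := fun s =>
    (ContinuousLinearMap.isClosed_ker (E s - 1)).completeSpace_coe
  -- Idempotence is automatic: multiply the resolution of the identity by `E s`.
  have hidem : ∀ s, E s * E s = E s := fun s => by
    have := congrArg (E s * ·) hsum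
    simp only [mul_one, Finset.mul_sum] at this
    rwa [Finset.sum_eq_single s (fun t _ ht => horth s t ht.symm) (by simp)] at this
  choose u b hb using fun s => exists_hilbertBasis ℂ (K s)
  let v : (Σ s, u s) → H := fun p => (b p.1 p.2 : K p.1)
  have hv : ∀ p, E p.1 (v p) = v p := fun p => (hK _ _).mp (b p.1 p.2).2
  have hon : Orthonormal ℂ v := by
    refine ⟨fun p => (b p.1).orthonormal.1 p.2, ?_⟩
    rintro ⟨s, x⟩ ⟨t, y⟩ hne
    by_cases hst : s = t
    · subst hst
      exact (b s).orthonormal.2 (fun h : x = y => hne (by rw [h]))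
    · change inner ℂ (v ⟨s, x⟩) (v ⟨t, y⟩) = 0
      rw [← hv ⟨s, x⟩, ← hv ⟨t, y⟩, hsym, ← mul_apply_eq_comp, horth s t hst]
      simp
  have hbot : (Submodule.span ℂ (Set.range v))ᗮ = ⊥ := by
    rw [Submodule.eq_bot_iff]
    intro x hx
    have hEx : ∀ s, E s x = 0 := fun s => by
      have hmem : E s x ∈ K s := (hK _ _).mpr (by
        rw [← mul_apply_eq_comp, hidem])
      have h0 : (⟨E s x, hmem⟩ : K s) = 0 := by
        apply (b s).repr.injective
        ext y
        rw [HilbertBasis.repr_apply_apply, map_zero]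
        change inner ℂ (v ⟨s, y⟩) (E s x) = 0
        rw [← hsym, hv ⟨s, y⟩]
        exact (Submodule.mem_orthogonal _ _).mp hx _ (Submodule.subset_span ⟨⟨s, y⟩, rfl⟩)
      exact congrArg Subtype.val h0
    have := congrArg (fun T : H →L[ℂ] H => T x) hsum
    simp only [sum_apply, hEx, Finset.sum_const_zero] at this
    simpa using this.symm
  refine ⟨_, HilbertBasis.mkOfOrthogonalEqBot hon hbot, Sigma.fst, fun p => ?_⟩
  simpa using hv p

section Quantum

variable {A : Type*} [Ring A]

/-- The product of the members `s 0, …, s 3` of four families `R 0, …, R 3`. -/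
def prodFour (R : Fin 4 → ℤˣ → A) (s : Fin 4 → ℤˣ) : A :=
  R 0 (s 0) * R 1 (s 1) * R 2 (s 2) * R 3 (s 3)

theorem commute_prodFour {R : Fin 4 → ℤˣ → A} (hR : ∀ i j a b, Commute (R i a) (R j b))
    (i : Fin 4) (a : ℤˣ) (s : Fin 4 → ℤˣ) : Commute (R i a) (prodFour R s) :=
  (((hR _ _ _ _).mul_right (hR _ _ _ _)).mul_right (hR _ _ _ _)).mul_right (hR _ _ _ _)

theorem mul_prodFour {R : Fin 4 → ℤˣ → A} (hR : ∀ i j a b, Commute (R i a) (R j b))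
    (hidem : ∀ i a, R i a * R i a = R i a) (s : Fin 4 → ℤˣ) (i : Fin 4) :
    R i (s i) * prodFour R s = prodFour R s := by
  unfold prodFour
  fin_cases i <;> simp only [Fin.zero_eta, Fin.mk_one, Fin.reduceFinMk, ← mul_assoc]
  · rw [hidem]
  · rw [(hR 1 0 _ _).eq, mul_assoc (R 0 _), hidem]
  · rw [(hR 2 0 _ _).eq, mul_assoc (R 0 _), (hR 2 1 _ _).eq, ← mul_assoc,
      mul_assoc (R 0 _ * R 1 _), hidem]
  · rw [(hR 3 0 _ _).eq, mul_assoc (R 0 _), (hR 3 1 _ _).eq, ← mul_assoc,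
      mul_assoc (R 0 _ * R 1 _), (hR 3 2 _ _).eq, ← mul_assoc, mul_assoc _ (R 3 _), hidem]

theorem sum_prodFour {R : Fin 4 → ℤˣ → A} (hsum : ∀ i, ∑ a, R i a = 1) :
    ∑ p : ℤˣ × ℤˣ × ℤˣ × ℤˣ, prodFour R ![p.1, p.2.1, p.2.2.1, p.2.2.2] = 1 := by
  simp only [Fintype.sum_prod_type]
  change ∑ a, ∑ b, ∑ c, ∑ d, R 0 a * R 1 b * R 2 c * R 3 d = 1
  simp only [← Finset.mul_sum, hsum, mul_one]

theorem isSelfAdjoint_prodFour [StarRing A] {R : Fin 4 → ℤˣ → A}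
    (hR : ∀ i j a b, Commute (R i a) (R j b)) (hsa : ∀ i a, IsSelfAdjoint (R i a))
    (s : Fin 4 → ℤˣ) : IsSelfAdjoint (prodFour R s) := by
  have h1 := ((hsa 0 (s 0)).commute_iff (hsa 1 (s 1))).mp (hR _ _ _ _)
  have h2 := (h1.commute_iff (hsa 2 (s 2))).mp ((hR _ _ _ _).mul_left (hR _ _ _ _))
  exact (h2.commute_iff (hsa 3 (s 3))).mp
    (((hR _ _ _ _).mul_left (hR _ _ _ _)).mul_left (hR _ _ _ _))

/-- At a coordinate where `s` and `t` differ, the two orthogonal factors can be brought next to each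
other. -/
theorem prodFour_mul_of_ne {R : Fin 4 → ℤˣ → A} (hR : ∀ i j a b, Commute (R i a) (R j b))
    (hself : ∀ i a b, R i a * R i b = if a = b then R i a else 0) {s t : Fin 4 → ℤˣ} (h : s ≠ t) :
    prodFour R s * prodFour R t = 0 := by
  obtain ⟨i, hi⟩ := Function.ne_iff.mp h
  have hidem : ∀ i a, R i a * R i a = R i a := fun i a => by rw [hself, if_pos rfl]
  rw [← mul_prodFour hR hidem s i, ← mul_prodFour hR hidem t i, (commute_prodFour hR i _ s).eq,
    mul_assoc, ← mul_assoc (R i (s i)), hself, if_neg hi]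
  simp

/-- The projectors of a quantum model of `K₄` are diagonal in a common Hilbert basis, with joint
eigenvalues given by outcome assignments. -/
theorem exists_hilbertBasis_deterministic {H : Type w} [NormedAddCommGroup H]
    [InnerProductSpace ℂ H] [CompleteSpace H] {Q : Event (⊤ : SimpleGraph (Fin 4)) → H →L[ℂ] H}
    (hproj : ∀ v, IsStarProjection (Q v)) (hsum : ∀ e, IsHyperedge ⊤ e → ∑ v ∈ e, Q v = 1)
    (horth : ∀ u v, Orthogonal ⊤ u v → Q u * Q v = 0) :
    ∃ (ι : Type w) (e : HilbertBasis ι ℂ H) (k : ι → Fin 4 → ℤˣ),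
      ∀ i v, Q v (e i) = (deterministic ⊤ (k i) v : ℂ) • e i := by
  have hidemQ : ∀ v, IsIdempotentElem (Q v) := fun v => (hproj v).isIdempotentElem
  have hadj : ∀ i : Fin 4, (⊤ : SimpleGraph (Fin 4)).Adj i (i + 1) := by decide
  let R : Fin 4 → ℤˣ → H →L[ℂ] H := fun i a => ∑ b, Q (ev ⊤ i (i + 1) (hadj i) a b)
  have hRj : ∀ i j (h : (⊤ : SimpleGraph (Fin 4)).Adj i j) a, R i a = ∑ b, Q (ev ⊤ i j h a b) :=
    fun i j h a => marginal_eq hsum _ h a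
  have hRR : ∀ i j (h : (⊤ : SimpleGraph (Fin 4)).Adj i j) a b,
      R i a * R j b = Q (ev ⊤ i j h a b) := fun i j h a b => by
    rw [hRj i j h, hRj j i h.symm, marginal_mul_marginal hidemQ horth]
  have hself : ∀ i a b, R i a * R i b = if a = b then R i a else 0 := fun i a b =>
    marginal_mul_self hidemQ horth (hadj i) a b
  have hidem : ∀ i a, R i a * R i a = R i a := fun i a => by rw [hself, if_pos rfl]
  have hcomm : ∀ i j a b, Commute (R i a) (R j b) := fun i j a b => by
    rw [commute_iff_eq]
    by_cases hij : i = j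
    · subst hij
      rw [hself, hself]
      by_cases hab : a = b
      · rw [hab]
      · rw [if_neg hab, if_neg (Ne.symm hab)]
    -- Both products equal the projector of the same event. This uses that any two vertices of `K₄`
    -- are adjacent.
    · rw [hRR i j hij, hRR j i (Ne.symm hij), ← ev_swap]
  have hsa : ∀ i a, IsSelfAdjoint (R i a) := fun i a =>
    isSelfAdjoint_sum _ fun b _ => (hproj _).isSelfAdjoint
  obtain ⟨ι, e, k, he⟩ := exists_hilbertBasis_of_sum_projections
    (fun p : ℤˣ × ℤˣ × ℤˣ × ℤˣ => prodFour R ![p.1, p.2.1, p.2.2.1, p.2.2.2])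
    (fun p => isSelfAdjoint_prodFour hcomm hsa _)
    (fun p q hpq => prodFour_mul_of_ne hcomm hself fun h => hpq (by
      have h0 := congrFun h 0
      have h1 := congrFun h 1
      have h2 := congrFun h 2
      have h3 := congrFun h 3
      exact Prod.ext h0 (Prod.ext h1 (Prod.ext h2 h3))))
    (sum_prodFour fun i => sum_marginal hsum (hadj i))
  refine ⟨ι, e, fun i => ![(k i).1, (k i).2.1, (k i).2.2.1, (k i).2.2.2], fun i v => ?_⟩
  suffices hs : ∀ s : Fin 4 → ℤˣ, prodFour R s (e i) = e i →
      Q v (e i) = (deterministic ⊤ s v : ℂ) • e i from hs _ (he i)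
  intro s hei
  have hx : ∀ j a, R j a (e i) = if a = s j then e i else 0 := fun j a => by
    rw [← hei, ← mul_prodFour hcomm hidem s j, ← mul_apply_eq_comp, ← mul_assoc, hself]
    split_ifs with h
    · rw [h]
    · simp
  obtain ⟨j, l, h, a, b, rfl⟩ := exists_eq_ev ⊤ v
  rw [← hRR j l h, deterministic_ev, mul_apply_eq_comp, hx]
  by_cases hb : b = s l
  · rw [if_pos hb, hx]
    by_cases ha : a = s j
    · simp [ha, hb]
    · simp [ha, Ne.symm ha]
  · simp [hb, Ne.symm hb]

theorem HasTrace.hasSum_re {H : Type w} [NormedAddCommGroup H] [InnerProductSpace ℂ H]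
    {T : H →L[ℂ] H} {t : ℝ} (h : HasTrace T t) {ι : Type w} (e : HilbertBasis ι ℂ H) :
    HasSum (fun i => (inner ℂ (e i) (T (e i))).re) t := by
  simpa using Complex.hasSum_re (h ι e)

/-- Computing the traces in the joint eigenbasis writes `P` as a mixture of deterministic behaviours
with weights `⟨e_i, ρ e_i⟩`, which are nonnegative and sum to `1`. -/
theorem le_of_mem_quantumSet {P : Event (⊤ : SimpleGraph (Fin 4)) → ℝ}
    (hP : P ∈ quantumSet.{w} (⊤ : SimpleGraph (Fin 4)))
    {f : (Event (⊤ : SimpleGraph (Fin 4)) → ℝ) →ₗ[ℝ] ℝ} {β : ℝ}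
    (hf : ∀ s, f (deterministic ⊤ s) ≤ β) : f P ≤ β := by
  obtain ⟨H, _, _, _, ρ, Q, hρ, htr, hproj, hsum, horth, hPQ⟩ := hP
  obtain ⟨ι, e, k, he⟩ := exists_hilbertBasis_deterministic hproj hsum horth
  have hq0 : ∀ i, 0 ≤ (inner ℂ (e i) (ρ (e i))).re := fun i =>
    (Complex.le_def.mp (hρ.inner_nonneg_right (e i))).1
  have hq1 := HasTrace.hasSum_re (t := 1) (by simpa using htr) e
  have hPsum : HasSum (fun i => (inner ℂ (e i) (ρ (e i))).re • deterministic ⊤ (k i)) P := by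
    rw [Pi.hasSum]
    intro v
    convert (hPQ v).hasSum_re e using 2 with i
    rw [mul_apply_eq_comp, he, map_smul, inner_smul_right, Complex.re_ofReal_mul]
    simp [mul_comm]
  -- The mixture may be infinite, so continuity of `f`, automatic in finite dimension, is needed to
  -- apply it termwise.
  have hfsum := (LinearMap.toContinuousLinearMap f).hasSum hPsum
  simp only [LinearMap.coe_toContinuousLinearMap', map_smul, smul_eq_mul] at hfsum
  simpa using hasSum_le (fun i => mul_le_mul_of_nonneg_left (hf (k i)) (hq0 i)) hfsum
    (hq1.mul_right β)

end Quantum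

end Contextuality
end

/-! ### A no-disturbance violation and comparison with exclusivity. -/

noncomputable section
namespace Contextuality

section Scenario

variable {V : Type*} [LinearOrder V]

/-- The behaviour that is uniform, in each context, on the three outcomes not predicted by `s`. -/
def avoiding (G : SimpleGraph V) (s : V → ℤˣ) : Event G → ℝ :=
  fun v => (1 - deterministic G s v) / 3

/-- In any context the predicted outcome `s i` has marginal `1/3` and the other one `2/3`. -/
theorem avoiding_mem_noDisturbance (G : SimpleGraph V) (s : V → ℤˣ) :
    avoiding G s ∈ noDisturbance G := by
  refine ⟨fun v => ?_, fun i j h => ?_, fun i j k hj hk a => ?_⟩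
  · rcases deterministic_eq_zero_or_one G s v with h | h <;> simp [avoiding, h]
  · simp only [avoiding, deterministic_ev, sum_unitsInt]
    rcases Int.units_eq_one_or (s i) with h1 | h1 <;>
      rcases Int.units_eq_one_or (s j) with h2 | h2 <;>
      simp [h1, h2, show (1 : ℤˣ) ≠ -1 by decide, show (-1 : ℤˣ) ≠ 1 by decide] <;> norm_num
  · simp only [avoiding, deterministic_ev, sum_unitsInt]
    by_cases h : s i = a <;>
      rcases Int.units_eq_one_or (s j) with h1 | h1 <;>
      rcases Int.units_eq_one_or (s k) with h2 | h2 <;>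
      simp [h, h1, h2, show (1 : ℤˣ) ≠ -1 by decide, show (-1 : ℤˣ) ≠ 1 by decide]

theorem sum_avoiding (G : SimpleGraph V) (s : V → ℤˣ) (S : Finset (Event G)) :
    ∑ v ∈ S, avoiding G s v = (S.card - ∑ v ∈ S, deterministic G s v) / 3 := by
  simp [avoiding, ← Finset.sum_div]

theorem sum_deterministic_of_lt_one {G : SimpleGraph V} {s : V → ℤˣ} {S : Finset (Event G)}
    (h : ∑ v ∈ S, deterministic G s v < 1) : ∑ v ∈ S, deterministic G s v = 0 := by
  refine Finset.sum_eq_zero fun v hv => (deterministic_eq_zero_or_one G s v).resolve_right ?_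
  intro h1
  have := Finset.single_le_sum (f := deterministic G s) (fun u _ => by
    rcases deterministic_eq_zero_or_one G s u with h | h <;> simp [h]) hv
  linarith

end Scenario

/-- An event fixes two of the four outcomes, leaving `2²` assignments. -/
theorem sum_deterministic_eq_four (v : Event (⊤ : SimpleGraph (Fin 4))) :
    ∑ s, deterministic ⊤ s v = 4 := by
  have h : ∀ v : Event (⊤ : SimpleGraph (Fin 4)), (Finset.univ.filter fun s : Fin 4 → ℤˣ =>
      s v.1.1.1 = v.2.1 ∧ s v.1.1.2 = v.2.2).card = 4 := by decide +kernel
  simp only [deterministic, Finset.sum_boole, h]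
  norm_num

/-- The behaviours `avoiding s` satisfy Consistent Exclusivity: a set of mutually orthogonal events of
`K₄` has at most four elements, and if it has four then every outcome assignment satisfies one of
them. -/
theorem satisfiesCE_avoiding (s : Fin 4 → ℤˣ) :
    SatisfiesCE ⊤ (avoiding (⊤ : SimpleGraph (Fin 4)) s) := by
  intro S hS
  rw [sum_avoiding]
  have hle : ∀ t, ∑ v ∈ S, deterministic ⊤ t v ≤ 1 := fun t => satisfiesCE_deterministic ⊤ t S hS
  have hsum : ∑ t, ∑ v ∈ S, deterministic ⊤ t v = S.card * 4 := by
    rw [Finset.sum_comm]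
    simp [sum_deterministic_eq_four]
  have hcard : (∑ _t : Fin 4 → ℤˣ, (1 : ℝ)) = 16 := by
    simp
  by_cases h : ∑ v ∈ S, deterministic ⊤ s v = 1
  -- Summing over all assignments gives `4|S| ≤ 16`, so `(|S| - 1)/3 ≤ 1`. In the other case `s`
  -- makes this strict, so `|S| ≤ 3` and `|S|/3 ≤ 1`.
  · have := Finset.sum_le_sum fun t (_ : t ∈ Finset.univ) => hle t
    rw [hcard, hsum] at this
    linarith
  · have h0 := sum_deterministic_of_lt_one (lt_of_le_of_ne (hle s) h)
    have := Finset.sum_lt_sum (fun t (_ : t ∈ Finset.univ) => hle t)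
      ⟨s, Finset.mem_univ s, lt_of_le_of_ne (hle s) h⟩
    rw [hcard, hsum] at this
    have h3 : S.card < 4 := by
      have : (S.card : ℝ) < (4 : ℕ) := by push_cast; linarith
      exact_mod_cast this
    have h3' : (S.card : ℝ) ≤ 3 := by exact_mod_cast Nat.le_of_lt_succ h3
    linarith

/-- The outcome assignment `-b`, at which the pentagonal inequality is least tight. -/
def antiPentagon : Fin 4 → ℤˣ := ![-1, -1, -1, 1]

/-- The outcome assignments at which the pentagonal inequality is tight. -/
def pentagonFacet : Finset (Fin 4 → ℤˣ) :=
  Finset.univ.filter fun s => ((s 0 : ℤ) + s 1 + s 2 - s 3 - 1) ^ 2 = 1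

/-- Put `t_i = b_i s_i`; tightness means that `t_1 + ⋯ + t_4` is `0` or `2`. Fixing two of the `t_i`
leaves three completions, or only one if both are `-1`, which is when the event agrees with `-b`. -/
theorem sum_pentagonFacet (v : Event (⊤ : SimpleGraph (Fin 4))) :
    ∑ s ∈ pentagonFacet, deterministic ⊤ s v = 3 - 2 * deterministic ⊤ antiPentagon v := by
  have h : ∀ v : Event (⊤ : SimpleGraph (Fin 4)), (pentagonFacet.filter fun s : Fin 4 → ℤˣ =>
      s v.1.1.1 = v.2.1 ∧ s v.1.1.2 = v.2.2).card =
      if antiPentagon v.1.1.1 = v.2.1 ∧ antiPentagon v.1.1.2 = v.2.2 then 1 else 3 := by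
    decide +kernel
  simp only [deterministic, Finset.sum_boole, h]
  split_ifs <;> norm_num

variable (c : ∀ i : Fin 4, {j : Fin 4 // (⊤ : SimpleGraph (Fin 4)).Adj i j})

theorem correlatorForm_eq_two_of_mem_pentagonFacet {s : Fin 4 → ℤˣ} (hs : s ∈ pentagonFacet) :
    correlatorForm ⊤ c pentagonWeight (deterministic ⊤ s) = 2 := by
  have h : ((s 0 : ℤ) + s 1 + s 2 - s 3 - 1) ^ 2 = 1 := (Finset.mem_filter.mp hs).2
  have h' : (sign (s 0) + sign (s 1) + sign (s 2) - sign (s 3) - 1) ^ 2 = 1 := by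
    unfold sign
    exact_mod_cast h
  rw [correlatorForm_deterministic, h']
  norm_num

theorem correlatorForm_antiPentagon :
    correlatorForm ⊤ c pentagonWeight (deterministic ⊤ antiPentagon) = -10 := by
  rw [correlatorForm_deterministic]
  simp [antiPentagon]
  norm_num

theorem edgeCorr_one {V : Type*} [LinearOrder V] (G : SimpleGraph V) [DecidableRel G.Adj]
    (c : ∀ i : V, {j : V // G.Adj i j}) (e : (suspension G).edgeSet) :
    edgeCorr G c e (fun _ => 1) = 0 := by
  obtain ⟨e, he⟩ := e
  induction e using Sym2.ind with
  | _ x y =>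
    change pairCorr G c x y _ = 0
    rcases x with _ | i <;> rcases y with _ | j
    · rfl
    · simp [pairCorr, single_apply]
    · simp [pairCorr, single_apply]
    · have h : G.Adj i j := he
      simp [pairCorr, corr_apply, h]

theorem correlatorForm_avoiding :
    correlatorForm ⊤ c pentagonWeight (avoiding ⊤ antiPentagon) = 10 / 3 := by
  have h1 : correlatorForm ⊤ c pentagonWeight (fun _ => 1) = 0 := by
    simp [correlatorForm, edgeCorr_one]
  have h2 : avoiding (⊤ : SimpleGraph (Fin 4)) antiPentagon =
      (1 / 3 : ℝ) • ((fun _ => 1) - deterministic ⊤ antiPentagon) := by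
    funext v
    simp [avoiding]
    ring
  rw [h2, map_smul, map_sub, h1, correlatorForm_antiPentagon]
  norm_num

theorem deterministic_mem_ncPolytope {V : Type*} [LinearOrder V] (G : SimpleGraph V)
    (s : V → ℤˣ) : deterministic G s ∈ ncPolytope G :=
  subset_convexHull ℝ _ ⟨s, rfl⟩

/-- No set of mutually orthogonal events defines the pentagonal facet: counting over the facet gives
`3 |S| - 2 d = 10` with `d ∈ {0, 1}` the number of events of `S` predicted by `antiPentagon`. -/
theorem pentagonFacet_ne {S : Finset (Event (⊤ : SimpleGraph (Fin 4)))}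
    (hS : MutuallyOrthogonal ⊤ S) :
    {P ∈ ncPolytope (⊤ : SimpleGraph (Fin 4)) | correlatorForm ⊤ c pentagonWeight P = 2} ≠
      {P ∈ ncPolytope (⊤ : SimpleGraph (Fin 4)) | ∑ v ∈ S, P v = 1} := by
  intro heq
  have hface : ∀ s, correlatorForm ⊤ c pentagonWeight (deterministic ⊤ s) = 2 ↔
      ∑ v ∈ S, deterministic ⊤ s v = 1 := fun s => by
    have := Set.ext_iff.mp heq (deterministic ⊤ s)
    simpa [deterministic_mem_ncPolytope] using this
  -- The assignment `-b` lies off the pentagonal face, so its sum over `S` is not `1`; being at most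
  -- `1`, it must be `0`.
  have hanti : ∑ v ∈ S, deterministic ⊤ antiPentagon v = 0 := by
    refine sum_deterministic_of_lt_one
      (lt_of_le_of_ne (satisfiesCE_deterministic ⊤ _ S hS) fun h => ?_)
    have := (hface antiPentagon).mpr h
    rw [correlatorForm_antiPentagon] at this
    norm_num at this
  have h1 : ∑ v ∈ S, ∑ s ∈ pentagonFacet, deterministic ⊤ s v = S.card * 3 := by
    simp only [sum_pentagonFacet, Finset.sum_sub_distrib, ← Finset.mul_sum, hanti]
    simp
  have h2 : ∑ s ∈ pentagonFacet, ∑ v ∈ S, deterministic ⊤ s v = 10 := by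
    rw [Finset.sum_congr rfl fun s hs =>
      (hface s).mp (correlatorForm_eq_two_of_mem_pentagonFacet c hs)]
    have : pentagonFacet.card = 10 := by decide +kernel
    simp [this]
  rw [Finset.sum_comm, h1] at h2
  have h3 : S.card * 3 = 10 := by exact_mod_cast h2
  omega

end Contextuality
end
open Contextuality in
theorem mainTheorem4
    (c : ∀ i : Fin 4, {j : Fin 4 // (⊤ : SimpleGraph (Fin 4)).Adj i j}) :
    -- the suspension of `K₄` is the complete graph on the five vertices `1, 2, 3, 4, O`
    suspension (⊤ : SimpleGraph (Fin 4)) = ⊤ ∧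
    -- the pentagonal inequality is facet-defining for the cut polytope of `K₅`
    IsFacetDefining (edgeForm (⊤ : SimpleGraph (Option (Fin 4))) pentagonWeight) 0
      (cutPolytope (⊤ : SimpleGraph (Option (Fin 4)))) ∧
    -- the correspondence identifies the noncontextual polytope of `K₄` with the cut polytope
    -- of its suspension, and turns the pentagonal inequality into `correlatorForm ≤ 2`
    Set.BijOn (toCut (⊤ : SimpleGraph (Fin 4)) c) (ncPolytope ⊤) (cutPolytope (suspension ⊤)) ∧
    (∀ P, edgeForm (suspension (⊤ : SimpleGraph (Fin 4))) pentagonWeight (toCut ⊤ c P) =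
      (correlatorForm ⊤ c pentagonWeight P - 2) / 2) ∧
    -- tight noncontextuality inequality
    IsFacetDefining (correlatorForm (⊤ : SimpleGraph (Fin 4)) c pentagonWeight) 2
      (ncPolytope ⊤) ∧
    -- no quantum violation
    (∀ P ∈ quantumSet.{w} (⊤ : SimpleGraph (Fin 4)), correlatorForm ⊤ c pentagonWeight P ≤ 2) ∧
    -- violated by a no-disturbance behaviour, even by one that satisfies every constraint
    -- of Consistent Exclusivity
    (∃ P ∈ noDisturbance (⊤ : SimpleGraph (Fin 4)),
      SatisfiesCE ⊤ P ∧ 2 < correlatorForm ⊤ c pentagonWeight P) ∧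
    -- no Consistent Exclusivity constraint is equivalent to it on no-disturbance behaviours,
    -- nor defines the same facet
    (∀ S : Finset (Event (⊤ : SimpleGraph (Fin 4))), MutuallyOrthogonal ⊤ S →
      ¬ (∀ P ∈ noDisturbance (⊤ : SimpleGraph (Fin 4)),
        correlatorForm ⊤ c pentagonWeight P ≤ 2 ↔ ∑ v ∈ S, P v ≤ 1) ∧
      {P ∈ ncPolytope (⊤ : SimpleGraph (Fin 4)) | correlatorForm ⊤ c pentagonWeight P = 2} ≠
        {P ∈ ncPolytope (⊤ : SimpleGraph (Fin 4)) | ∑ v ∈ S, P v = 1}) := by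
  refine ⟨suspension_top, isFacetDefining_pentagon rfl, bijOn_toCut ⊤ c, edgeForm_toCut c,
    isFacetDefining_correlatorForm c, fun P hP => le_of_mem_quantumSet hP fun s =>
      (isFacetDefining_correlatorForm c).1 _ (deterministic_mem_ncPolytope ⊤ s), ?_, ?_⟩
  · refine ⟨_, avoiding_mem_noDisturbance ⊤ antiPentagon, satisfiesCE_avoiding _, ?_⟩
    rw [correlatorForm_avoiding]
    norm_num
  · refine fun S hS => ⟨fun h => ?_, pentagonFacet_ne c hS⟩
    -- One behaviour refutes every equivalence: it satisfies all exclusivity constraints and still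
    -- has `f = 10/3`.
    have := (h _ (avoiding_mem_noDisturbance ⊤ antiPentagon)).mpr (satisfiesCE_avoiding _ S hS)
    rw [correlatorForm_avoiding] at this
    norm_num at this
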